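/- Let $F$ be a field of characteristic $0$ and let $q\in F^\times$ not be a root of unity (for instance $F=\mathbb{Q}(q)$ with $q$ an indeterminate). For $n\in\mathbb{Z}$ put $\{n\}_q=\dfrac{q^{-n}-(-1)^nq^n}{q+q^{-1}}$. **The algebra.** $U_q^+=U_q^+(C(2)^{(2)})$ is the unital associative $F$-algebra with generators $A=e_{\alpha_0}$, $B=e_{\alpha_1}$ (where $\alpha_0=\delta-\alpha$, $\alpha_1=\alpha$, both odd, $\delta=\alpha_0+\alpha_1$, $(\alpha_0,\alpha_0)=(\alpha_1,\alpha_1)=2$, $(\alpha_0,\alpha_1)=-2$) and the $q$-Serre relations $[B,[B,[B,A]_q]_q]_q=0$ and $[[[B,A]_q,A]_q,A]_q=0$, where $[e_\beta,e_{\beta'}]_q=e_\beta e_{\beta'}-(-1)^{\vartheta(\beta)\vartheta(\beta')}q^{(\beta,\beta')}e_{\beta'}e_\beta$ for elements of weights $\beta,\beta'$, and $\vartheta(\beta)\in\{0,1\}$ is the parity of $\beta$. Write $[e_\beta,e_{\beta'}]=e_\beta e_{\beta'}-(-1)^{\vartheta(\beta)\vartheta(\beta')}e_{\beta'}e_\beta$.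 The root vectors of Damiani type are defined by $E_{\alpha_0}=A$, $E_{\alpha_1}=B$, $E_\delta=q^{-2}BA+AB$ and, for $n\ge1$, $$E_{n\delta+\alpha_0}=\frac{[E_{(n-1)\delta+\alpha_0},E_\delta]}{q-q^{-1}},\qquad E_{n\delta+\alpha_1}=\frac{[E_\delta,E_{(n-1)\delta+\alpha_1}]}{q-q^{-1}},\qquad E_{n\delta}=q^{-2}E_{(n-1)\delta+\alpha_1}A+A\,E_{(n-1)\delta+\alpha_1}.$$ **The $q$-shuffle superalgebra.** $\mathbb{V}$ is the $F$-vector space with basis the words in the letters $x,y$, with the bilinear product $\star$ determined by $1\star v=v\star 1=v$ and, for nontrivial words $u=u_1\cdots u_r$ and $v=v_1\cdots v_s$, $$u\star v=u_1\big((u_2\cdots u_r)\star v\big)+(-1)^r q^{\langle u_1,v_1\rangle+\cdots+\langle u_r,v_1\rangle}\,v_1\big(u\star(v_2\cdots v_s)\big),$$ where $\langle x,x\rangle=\langle y,y\rangle=2$ and $\langle x,y\rangle=\langle y,x\rangle=-2$. This product is associative, and there is a unique algebra homomorphism $\varphi:U_q^+\to(\mathbb{V},\star)$ with $A\mapsto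 x$, $B\mapsto y$. **Catalan elements.** Put $\bar x=1$, $\bar y=-1$. Let $\mathrm{Cat}_n$ be the set of words $a_1\cdots a_{2n}$ with $\bar a_1+\cdots+\bar a_{2n}=0$ and $\bar a_1+\cdots+\bar a_i\ge0$ for all $i$. Put $C^s(1)=1$ for the empty word $1$ and, for $n\ge1$ and $w\in\mathrm{Cat}_n$, $$C^s(w)=\sum_{v=a_1\cdots a_{2n-2}\in\mathrm{Cat}_{n-1}}C^s(v)\sum_i(-1)^i\{2+2\bar a_1+\cdots+2\bar a_i\}_q,$$ the inner sum being over all $0\le i\le 2n-2$ with $w=a_1\cdots a_i\,x\,a_{i+1}\cdots a_{2n-2}\,y$. Put $C^s_n=\sum_{w\in\mathrm{Cat}_n}C^s(w)\,w$. **Theorem.** For all $n\ge0$, $$\varphi(E_{n\delta+\alpha_0})=q^{-2n}(q+q^{-1})^{2n}\,xC^s_n,\qquad \varphi(E_{n\delta+\alpha_1})=q^{-2n}(q+q^{-1})^{2n}\,C^s_ny,$$ and for all $n\ge1$, $$\varphi(E_{n\delta})=-q^{-2n}(q+q^{-1})^{2n-1}\,C^s_n,$$ where $xC^s_n$ and $C^s_ny$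 are concatenation products. -/

import Mathlib

namespace C22

noncomputable section

/-! ### Words, heights, Catalan words -/

/-- The two letters `x`, `y` of the alphabet; both are odd. -/
inductive Letter
  | x
  | y
  deriving DecidableEq

instance : Fintype Letter := ⟨{.x, .y}, fun a => by cases a <;> simp⟩

/-- The pairing on letters: `⟨x,x⟩ = ⟨y,y⟩ = 2`, `⟨x,y⟩ = ⟨y,x⟩ = -2`. -/
def pairing : Letter → Letter → ℤ
  | .x, .x => 2
  | .x, .y => -2
  | .y, .x => -2
  | .y, .y => 2

/-- `x̄ = 1`, `ȳ = -1`. -/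
def bar : Letter → ℤ
  | .x => 1
  | .y => -1

/-- `ā₁ + ⋯ + āₙ` for the word `a₁ ⋯ aₙ`. -/
def height (w : List Letter) : ℤ := (w.map bar).sum

/-- A word is Catalan when it is balanced and all its initial segments have height `≥ 0`. -/
def IsCatalan (w : List Letter) : Prop :=
  height w = 0 ∧ ∀ i ≤ w.length, 0 ≤ height (w.take i)

instance (w : List Letter) : Decidable (IsCatalan w) := by
  unfold IsCatalan; infer_instance

/-- The finite set of Catalan words of length `2 n`. -/
def Cat (n : ℕ) : Finset (List Letter) :=
  ((Finset.univ : Finset (Fin (2 * n) → Letter)).image List.ofFn).filter IsCatalan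

/-! ### The `q`-shuffle superalgebra -/

variable {F : Type*} [Field F]

/-- The vector space `𝕍` with basis the words in `x, y`; its multiplication (below) is the
`q`-shuffle superproduct. -/
def V (F : Type*) [Field F] (_q : Fˣ) : Type _ := List Letter →₀ F

instance (q : Fˣ) : AddCommGroup (V F q) := inferInstanceAs (AddCommGroup (List Letter →₀ F))
instance (q : Fˣ) : Module F (V F q) := inferInstanceAs (Module F (List Letter →₀ F))

/-- A word as an element of `𝕍`. -/
def word (q : Fˣ) (w : List Letter) : V F q := Finsupp.single w (1 : F)

/-- The linear map out of `𝕍` with prescribed values on words. -/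
def onWords {M : Type*} [AddCommGroup M] [Module F M] (q : Fˣ) (f : List Letter → M) :
    V F q →ₗ[F] M :=
  Finsupp.lift M F (List Letter) f

@[simp] theorem onWords_word {M : Type*} [AddCommGroup M] [Module F M] (q : Fˣ)
    (f : List Letter → M) (w : List Letter) : onWords q f (word q w) = f w := by
  have h : Finsupp.lift M F (List Letter) f (Finsupp.single w (1 : F)) = f w := by
    simp [Finsupp.lift_apply]
  exact h

theorem ext_words {M : Type*} [AddCommGroup M] [Module F M] {q : Fˣ}
    {f g : V F q →ₗ[F] M} (h : ∀ w, f (word q w) = g (word q w)) : f = g :=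
  Finsupp.lhom_ext' fun w => LinearMap.ext_ring (h w)

/-- The concatenation (free) product on `𝕍`, as a bilinear map. -/
def conc (q : Fˣ) : V F q →ₗ[F] V F q →ₗ[F] V F q :=
  onWords q fun u => onWords q fun v => word q (u ++ v)

/-- `(-1)^r q^(⟨u₁,b⟩ + ⋯ + ⟨u_r,b⟩)` for the word `u = u₁ ⋯ u_r` and the letter `b`. -/
def braid (q : Fˣ) (u : List Letter) (b : Letter) : F :=
  (-1) ^ u.length * ((q ^ (u.map fun a => pairing a b).sum : Fˣ) : F)

/-- The `q`-shuffle superproduct of two words: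
`1 ⋆ v = v`, `u ⋆ 1 = u`, and, for `u = u₁ ⋯ u_r`, `v = v₁ ⋯ v_s` with `r, s ≥ 1`,
`u ⋆ v = u₁ ((u₂ ⋯ u_r) ⋆ v) + (-1)^r q^(⟨u₁,v₁⟩ + ⋯ + ⟨u_r,v₁⟩) v₁ (u ⋆ (v₂ ⋯ v_s))`. -/
def shuffleWord (q : Fˣ) : List Letter → List Letter → V F q
  | [], v => word q v
  | a :: u, [] => word q (a :: u)
  | a :: u, b :: v =>
      conc q (word q [a]) (shuffleWord q u (b :: v)) +
        braid q (a :: u) b • conc q (word q [b]) (shuffleWord q (a :: u) v)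
termination_by u v => u.length + v.length

/-- The `q`-shuffle superproduct on `𝕍`, extended bilinearly from words. -/
def shuffle (q : Fˣ) : V F q →ₗ[F] V F q →ₗ[F] V F q :=
  onWords q fun u => onWords q fun v => shuffleWord q u v

@[simp] theorem shuffle_word (q : Fˣ) (u v : List Letter) :
    shuffle q (word q u) (word q v) = shuffleWord q u v := by
  simp [shuffle]

@[simp] theorem conc_word (q : Fˣ) (u v : List Letter) :
    conc q (word q u) (word q v) = word q (u ++ v) := by
  simp [conc]

/-- The diagonal operator `w ↦ braid w b • w`. -/
def twist (q : Fˣ) (b : Letter) : V F q →ₗ[F] V F q := onWords q fun w => braid q w b • word q w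

theorem braid_cons (q : Fˣ) (a b : Letter) (u : List Letter) :
    braid q (a :: u) b = braid q [a] b * braid q u b := by
  have hq : (q : F) ≠ 0 := q.ne_zero
  simp [braid, pow_succ, zpow_add₀ hq]; ring

theorem twist_conc (q : Fˣ) (a b : Letter) (f : V F q) :
    twist q b (conc q (word q [a]) f) = braid q [a] b • conc q (word q [a]) (twist q b f) := by
  have h : twist q b ∘ₗ conc q (word q [a]) =
      braid q [a] b • (conc q (word q [a]) ∘ₗ twist q b) := by
    refine ext_words fun w => ?_
    simp [twist, smul_smul, braid_cons q a b w]
  simpa using LinearMap.congr_fun h f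

theorem shuffle_nil_left (q : Fˣ) (f : V F q) : shuffle q (word q []) f = f := by
  have h : shuffle q (word q []) = LinearMap.id := by
    refine ext_words fun w => ?_
    simp [shuffleWord]
  simpa using LinearMap.congr_fun h f

theorem shuffleWord_nil_right (q : Fˣ) (u : List Letter) :
    shuffleWord q u [] = word q u := by
  cases u <;> simp [shuffleWord]

theorem shuffle_nil_right (q : Fˣ) (f : V F q) : shuffle q f (word q []) = f := by
  have h : (shuffle q).flip (word q []) = LinearMap.id := by
    refine ext_words fun w => ?_
    simp [shuffleWord_nil_right]
  simpa using LinearMap.congr_fun h f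

theorem twist_shuffleWord (q : Fˣ) (c : Letter) : ∀ u v : List Letter,
    twist q c (shuffleWord q u v) = (braid q u c * braid q v c) • shuffleWord q u v
  | [], v => by simp [shuffleWord, twist, braid]
  | a :: u, [] => by simp [shuffleWord, twist, braid]
  | a :: u, b :: v => by
      rw [shuffleWord]
      simp only [map_add, map_smul, twist_conc, twist_shuffleWord q c u (b :: v),
        twist_shuffleWord q c (a :: u) v, smul_add, smul_smul, braid_cons q a c u,
        braid_cons q b c v]
      congr 2 <;> ring
termination_by u v => u.length + v.length

theorem shuffle_conc (q : Fˣ) (a b : Letter) (f g : V F q) :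
    shuffle q (conc q (word q [a]) f) (conc q (word q [b]) g) =
      conc q (word q [a]) (shuffle q f (conc q (word q [b]) g)) +
        conc q (word q [b]) (shuffle q (twist q b (conc q (word q [a]) f)) g) := by
  have h : ((shuffle q).compl₂ (conc q (word q [b]))) ∘ₗ conc q (word q [a]) =
      (((shuffle q).compl₂ (conc q (word q [b]))).compr₂ (conc q (word q [a]))) +
        ((shuffle q).compr₂ (conc q (word q [b]))) ∘ₗ twist q b ∘ₗ conc q (word q [a]) := by
    refine ext_words fun u => ext_words fun v => ?_
    simp [shuffleWord, twist]
  simpa using LinearMap.congr_fun (LinearMap.congr_fun h f) g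

theorem shuffle_assoc_word (q : Fˣ) : ∀ u v w : List Letter,
    shuffle q (shuffle q (word q u) (word q v)) (word q w) =
      shuffle q (word q u) (shuffle q (word q v) (word q w))
  | [], v, w => by rw [shuffle_nil_left, shuffle_nil_left]
  | a :: u, [], w => by rw [shuffle_nil_left, shuffle_nil_right]
  | a :: u, b :: v, [] => by rw [shuffle_nil_right, shuffle_nil_right]
  | a :: u, b :: v, c :: w => by
      have h1 := shuffle_assoc_word q u (b :: v) (c :: w)
      have h2 := shuffle_assoc_word q (a :: u) v (c :: w)
      have h3 := shuffle_assoc_word q (a :: u) (b :: v) w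
      have e : ∀ (d : Letter) (t : List Letter),
          word q (d :: t) = conc q (word q [d]) (word q t) := fun d t => by simp
      have t1 : ∀ (d e : Letter) (t : List Letter),
          twist q e (word q (d :: t)) = braid q (d :: t) e • word q (d :: t) := fun d e t => by
        simp [twist]
      have key : shuffle q (word q (a :: u)) (word q (b :: v)) =
          conc q (word q [a]) (shuffle q (word q u) (word q (b :: v))) +
          braid q (a :: u) b • conc q (word q [b]) (shuffle q (word q (a :: u)) (word q v)) := by
        simp [shuffleWord]
      have key2 : shuffle q (word q (b :: v)) (word q (c :: w)) =
          conc q (word q [b]) (shuffle q (word q v) (word q (c :: w))) +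
          braid q (b :: v) c • conc q (word q [c]) (shuffle q (word q (b :: v)) (word q w)) := by
        simp [shuffleWord]
      have L : shuffle q (shuffle q (word q (a :: u)) (word q (b :: v))) (word q (c :: w)) =
          conc q (word q [a]) (shuffle q (shuffle q (word q u) (word q (b :: v)))
            (word q (c :: w))) +
          braid q (a :: u) b • conc q (word q [b]) (shuffle q (shuffle q (word q (a :: u))
            (word q v)) (word q (c :: w))) +
          conc q (word q [c]) (shuffle q (twist q c (shuffle q (word q (a :: u))
            (word q (b :: v)))) (word q w)) := by
        rw [key]
        simp only [map_add, map_smul, LinearMap.add_apply, LinearMap.smul_apply]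
        rw [e c w, shuffle_conc, shuffle_conc]
        simp only [smul_add]
        abel
      have R : shuffle q (word q (a :: u)) (shuffle q (word q (b :: v)) (word q (c :: w))) =
          conc q (word q [a]) (shuffle q (word q u) (shuffle q (word q (b :: v))
            (word q (c :: w)))) +
          braid q (a :: u) b • conc q (word q [b]) (shuffle q (word q (a :: u))
            (shuffle q (word q v) (word q (c :: w)))) +
          (braid q (a :: u) c * braid q (b :: v) c) •
            conc q (word q [c]) (shuffle q (word q (a :: u)) (shuffle q (word q (b :: v))
              (word q w))) := by
        rw [key2]
        simp only [map_add, map_smul]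
        rw [e a u, shuffle_conc, shuffle_conc, ← e a u, t1, t1]
        simp only [map_smul, LinearMap.smul_apply, smul_add, smul_smul,
          mul_comm (braid q (a :: u) c)]
        abel
      rw [L, R, h1, h2, shuffle_word q (a :: u) (b :: v), twist_shuffleWord, map_smul,
        LinearMap.smul_apply, map_smul, ← shuffle_word, h3]
termination_by u v w => u.length + v.length + w.length

theorem shuffle_assoc (q : Fˣ) (f g h : V F q) :
    shuffle q (shuffle q f g) h = shuffle q f (shuffle q g h) := by
  have h1 : ∀ u v : List Letter, shuffle q (shuffle q (word q u) (word q v)) =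
      shuffle q (word q u) ∘ₗ shuffle q (word q v) := fun u v =>
    ext_words fun w => by simpa using shuffle_assoc_word q u v w
  have h2 : ∀ (u : List Letter), (shuffle q) ∘ₗ (shuffle q (word q u)) =
      (LinearMap.llcomp F _ _ _ (shuffle q (word q u))) ∘ₗ shuffle q := fun u =>
    ext_words fun v => h1 u v
  have h3 : (shuffle q).compr₂ (shuffle q) =
      (LinearMap.lcomp F _ (shuffle q)) ∘ₗ (LinearMap.llcomp F _ _ _) ∘ₗ shuffle q :=
    ext_words fun u => h2 u
  simpa using LinearMap.congr_fun (LinearMap.congr_fun (LinearMap.congr_fun h3 f) g) h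

instance (q : Fˣ) : Ring (V F q) :=
  { (inferInstance : AddCommGroup (V F q)) with
    mul := fun f g => shuffle q f g
    one := word q []
    left_distrib := fun f g h => map_add (shuffle q f) g h
    right_distrib := fun f g h => LinearMap.map_add₂ (shuffle q) f g h
    zero_mul := fun f => LinearMap.map_zero₂ (shuffle q) f
    mul_zero := fun f => map_zero (shuffle q f)
    mul_assoc := shuffle_assoc q
    one_mul := shuffle_nil_left q
    mul_one := shuffle_nil_right q }

theorem mul_def (q : Fˣ) (f g : V F q) : f * g = shuffle q f g := rfl

theorem one_def (q : Fˣ) : (1 : V F q) = word q [] := rfl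

instance (q : Fˣ) : Algebra F (V F q) :=
  Algebra.ofModule (fun r f g => LinearMap.map_smul₂ (shuffle q) r f g)
    (fun r f g => map_smul (shuffle q f) r g)

/-! ### Catalan elements -/

/-- `{n}_q = (q^(-n) - (-1)^n q^n) / (q + q^(-1))`. -/
def superBracket (q : Fˣ) (n : ℤ) : F :=
  (((q ^ (-n) : Fˣ) : F) - (((-1) ^ n * q ^ n : Fˣ) : F)) / ((q : F) + (q : F)⁻¹)

/-- The coefficient `C^s(w)` of a Catalan word `w` of length `2 n`: it is `1` for `n = 0`, and
`C^s(w) = ∑_{v ∈ Cat_{n-1}} C^s(v) ∑_i (-1)^i {2 + 2 ā₁ + ⋯ + 2 ā_i}_q` for `n ≥ 1`, the inner sum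
being over the `0 ≤ i ≤ m` with `w = a₁ ⋯ a_i x a_{i+1} ⋯ a_m y`, where `v = a₁ ⋯ a_m`. -/
def catCoeff (q : Fˣ) : ℕ → List Letter → F
  | 0, _ => 1
  | n + 1, w =>
      ∑ v ∈ Cat n, catCoeff q n v *
        ∑ i ∈ (Finset.range (v.length + 1)).filter
            (fun i => w = v.take i ++ Letter.x :: (v.drop i ++ [Letter.y])),
          (-1) ^ i * superBracket q (2 + 2 * height (v.take i))

/-- The `n`-th super Catalan element `C^s_n = ∑_{w ∈ Cat_n} C^s(w) w`. -/
def catalanElt (q : Fˣ) (n : ℕ) : V F q := ∑ w ∈ Cat n, catCoeff q n w • word q w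

/-! ### The positive part of `U_q(C(2)^(2))` and its root vectors -/

/-- The parity of the root `i α₀ + j α₁`; both simple roots are odd. -/
def parity (β : ℕ × ℕ) : ℕ := (β.1 + β.2) % 2

/-- The invariant form on the root lattice: `(α₀,α₀) = (α₁,α₁) = 2`, `(α₀,α₁) = -2`. -/
def rootForm (β γ : ℕ × ℕ) : ℤ := 2 * ((β.1 : ℤ) - β.2) * ((γ.1 : ℤ) - γ.2)

/-- The supercommutator `[a, b]` of elements attached to the roots `β`, `γ`. -/
def superComm {R : Type*} [Ring R] (β γ : ℕ × ℕ) (a b : R) : R :=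
  a * b - (-1) ^ (parity β * parity γ) * (b * a)

/-- The `q`-supercommutator `[a, b]_q` of elements attached to the roots `β`, `γ`. -/
def qSuperComm {R : Type*} [Ring R] [Algebra F R] (q : Fˣ) (β γ : ℕ × ℕ) (a b : R) : R :=
  a * b - ((-1) ^ (parity β * parity γ) * ((q ^ rootForm β γ : Fˣ) : F)) • (b * a)

/-- The two generators: `A` is attached to `α₀ = δ - α`, `B` to `α₁ = α`. -/
inductive Gen
  | A
  | B

/-- The left side of the `q`-Serre relation `[b, [b, [b, a]_q]_q]_q = 0`, with `a`, `b` attached to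
`α₀ = δ - α`, `α₁ = α`. -/
def serreLeft {R : Type*} [Ring R] [Algebra F R] (q : Fˣ) (a b : R) : R :=
  qSuperComm q (0, 1) (1, 2) b (qSuperComm q (0, 1) (1, 1) b (qSuperComm q (0, 1) (1, 0) b a))

/-- The left side of the `q`-Serre relation `[[[b, a]_q, a]_q, a]_q = 0`, with `a`, `b` attached to
`α₀ = δ - α`, `α₁ = α`. -/
def serreRight {R : Type*} [Ring R] [Algebra F R] (q : Fˣ) (a b : R) : R :=
  qSuperComm q (2, 1) (1, 0) (qSuperComm q (1, 1) (1, 0) (qSuperComm q (0, 1) (1, 0) b a) a) a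

/-- The cubic `q`-Serre relations. -/
inductive SerreRel (F : Type*) [Field F] (q : Fˣ) : FreeAlgebra F Gen → FreeAlgebra F Gen → Prop
  | left : SerreRel F q (serreLeft q (FreeAlgebra.ι F Gen.A) (FreeAlgebra.ι F Gen.B)) 0
  | right : SerreRel F q (serreRight q (FreeAlgebra.ι F Gen.A) (FreeAlgebra.ι F Gen.B)) 0

/-- `U_q^+(C(2)^(2))`: generators `A`, `B`, subject to the cubic `q`-Serre relations. -/
abbrev Uplus (F : Type*) [Field F] (q : Fˣ) : Type _ := RingQuot (SerreRel F q)

/-- The generator `A = e_{δ-α}`. -/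
def genA (q : Fˣ) : Uplus F q := RingQuot.mkAlgHom F (SerreRel F q) (FreeAlgebra.ι F Gen.A)

/-- The generator `B = e_α`. -/
def genB (q : Fˣ) : Uplus F q := RingQuot.mkAlgHom F (SerreRel F q) (FreeAlgebra.ι F Gen.B)

/-- `E_δ = q^(-2) B A + A B`. -/
def Edelta (q : Fˣ) : Uplus F q :=
  ((q : F) ^ 2)⁻¹ • (genB q * genA q) + genA q * genB q

/-- `E_{nδ+α₀}`: `E_{α₀} = A`, `E_{nδ+α₀} = [E_{(n-1)δ+α₀}, E_δ] / (q - q^(-1))`. -/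
def Ereal0 (q : Fˣ) : ℕ → Uplus F q
  | 0 => genA q
  | n + 1 => ((q : F) - (q : F)⁻¹)⁻¹ • superComm (n + 1, n) (1, 1) (Ereal0 q n) (Edelta q)

/-- `E_{nδ+α₁}`: `E_{α₁} = B`, `E_{nδ+α₁} = [E_δ, E_{(n-1)δ+α₁}] / (q - q^(-1))`. -/
def Ereal1 (q : Fˣ) : ℕ → Uplus F q
  | 0 => genB q
  | n + 1 => ((q : F) - (q : F)⁻¹)⁻¹ • superComm (1, 1) (n, n + 1) (Edelta q) (Ereal1 q n)

/-- `E_{nδ} = q^(-2) E_{(n-1)δ+α₁} A + A E_{(n-1)δ+α₁}` for `n ≥ 1`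
(so that `Eimag q 1 = Edelta q`); the value at `n = 0` is not used. -/
def Eimag (q : Fˣ) : ℕ → Uplus F q
  | 0 => 0
  | n + 1 => ((q : F) ^ 2)⁻¹ • (Ereal1 q n * genA q) + genA q * Ereal1 q n

/-! ### The shuffle map -/

theorem map_qSuperComm {R S : Type*} [Ring R] [Algebra F R] [Ring S] [Algebra F S]
    (f : R →ₐ[F] S) (q : Fˣ) (β γ : ℕ × ℕ) (a b : R) :
    f (qSuperComm q β γ a b) = qSuperComm q β γ (f a) (f b) := by
  simp [qSuperComm]

theorem serreLeft_shuffle (q : Fˣ) :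
    serreLeft q (word q [Letter.x] : V F q) (word q [Letter.y]) = 0 := by
  have hq : (q : F) ≠ 0 := q.ne_zero
  simp only [serreLeft, qSuperComm, parity, rootForm, mul_def, map_sub, map_add, map_smul,
    LinearMap.sub_apply, LinearMap.add_apply, LinearMap.smul_apply, shuffle_word, shuffleWord,
    conc_word, braid, pairing, smul_sub, smul_add, List.cons_append, List.nil_append,
    List.map_cons, List.map_nil, List.sum_cons, List.sum_nil, List.length_cons, List.length_nil,
    Units.val_zpow_eq_zpow_val]
  match_scalars <;> norm_num <;> field_simp <;> ring

theorem serreRight_shuffle (q : Fˣ) :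
    serreRight q (word q [Letter.x] : V F q) (word q [Letter.y]) = 0 := by
  have hq : (q : F) ≠ 0 := q.ne_zero
  simp only [serreRight, qSuperComm, parity, rootForm, mul_def, map_sub, map_add, map_smul,
    LinearMap.sub_apply, LinearMap.add_apply, LinearMap.smul_apply, shuffle_word, shuffleWord,
    conc_word, braid, pairing, smul_sub, smul_add, List.cons_append, List.nil_append,
    List.map_cons, List.map_nil, List.sum_cons, List.sum_nil, List.length_cons, List.length_nil,
    Units.val_zpow_eq_zpow_val]
  match_scalars <;> norm_num <;> field_simp <;> ring

/-- Images of the generators: `A ↦ x`, `B ↦ y`. -/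
def genImage (q : Fˣ) : Gen → V F q
  | .A => word q [Letter.x]
  | .B => word q [Letter.y]

/-- The algebra homomorphism `φ` from `U_q^+(C(2)^(2))` to the `q`-shuffle superalgebra `𝕍` with
`A ↦ x`, `B ↦ y`. -/
def phi (q : Fˣ) : Uplus F q →ₐ[F] V F q :=
  RingQuot.liftAlgHom F ⟨FreeAlgebra.lift F (genImage q), by
    intro a b h
    cases h
    · simpa [serreLeft, map_qSuperComm, genImage] using serreLeft_shuffle q
    · simpa [serreRight, map_qSuperComm, genImage] using serreRight_shuffle q⟩

theorem phi_genA (q : Fˣ) : phi q (genA q : Uplus F q) = word q [Letter.x] := by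
  simp [phi, genA, genImage]

theorem phi_genB (q : Fˣ) : phi q (genB q : Uplus F q) = word q [Letter.y] := by
  simp [phi, genB, genImage]

end

end C22

namespace C22

noncomputable section

variable {F : Type*} [Field F]

/-! Put Q = -q². Since (-1)^r depends only on the parity of a word's height, moving a letter b past
a word u costs just Q^(b̄ · height u), so every computation becomes one about lattice paths.

The heart of the proof is a product formula: up to a power of `catalanScale`, the Catalan element
C^s_n is `pathSum` of length 2n from height 0, in which a word is weighted by a product over its
steps. A y step from height 0 has weight Q - Q = 0, so only Catalan words survive. The definition of
C^s inserts an x and appends a final y; in shuffle terms this says Q x⋆(C^s_n y) - (C^s_n y)⋆x = (q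
+ q⁻¹) C^s_{n+1}. Path sums obey the same recursion up to scale (`exchangeX`), hence
`catalanElt_eq_pathSum`.

Unlike the sum defining C^s, path sums unfold at their first letter. Relations stated at every
starting height h therefore follow by induction on the length: exchange with y, exchange with x, and
the commutator with xy. Their correction terms carry factors that vanish at the heights finally
used, h = 0 and h = -1.

Finally φ(E_δ) is a multiple of the single word xy, so the recursions for the real root vectors
become commutators with xy, namely [xC^s_n, xy] = (q + q⁻¹) xC^s_{n+1} and [xy, C^s_n y] = (q + q⁻¹)
C^s_{n+1} y. The imaginary root vectors come from the recursion for C^s_n itself. The scalars q ±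
q⁻¹ are invertible because q² ≠ 1 and q⁴ ≠ 1. -/

/-- `Q = -q²`, in terms of which the super braiding is the bosonic one: `x, x ↦ Q`, `x, y ↦ Q⁻¹`. -/
def superBase (q : Fˣ) : F := -(q : F) ^ 2

theorem superBase_ne_zero (q : Fˣ) : superBase q ≠ 0 :=
  neg_ne_zero.mpr (pow_ne_zero 2 q.ne_zero)

/-! ### Heights, and shuffling with words of length one or two -/

@[simp] theorem height_nil : height [] = 0 := rfl

@[simp] theorem height_cons (a : Letter) (w : List Letter) :
    height (a :: w) = bar a + height w := by
  simp [height]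

@[simp] theorem height_append (u v : List Letter) : height (u ++ v) = height u + height v := by
  simp [height]

theorem braid_eq_zpow (q : Fˣ) (u : List Letter) (b : Letter) :
    braid q u b = superBase q ^ (bar b * height u) := by
  induction u with
  | nil => simp [braid]
  | cons a u ih =>
    rw [braid_cons, ih, height_cons, mul_add, zpow_add₀ (superBase_ne_zero q)]
    congr 1
    have hq := q.ne_zero
    cases a <;> cases b <;> simp [braid, pairing, bar, superBase]

/-- Prepending a letter. -/
abbrev consL (q : Fˣ) (a : Letter) : V F q →ₗ[F] V F q := conc q (word q [a])

theorem consL_nil (q : Fˣ) (a : Letter) : consL q a (word q []) = word q [a] := by simp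

theorem twist_nil (q : Fˣ) (a : Letter) : twist q a (word q [] : V F q) = word q [] := by
  simp [twist, braid]

theorem twist_letter (q : Fˣ) (a b : Letter) :
    twist q b (word q [a] : V F q) = superBase q ^ (bar b * bar a) • word q [a] := by
  simp [twist, braid_eq_zpow]

theorem twist_consL (q : Fˣ) (a b : Letter) (f : V F q) :
    twist q b (consL q a f) = superBase q ^ (bar b * bar a) • consL q a (twist q b f) := by
  rw [twist_conc, braid_eq_zpow]; simp

theorem consL_shuffle_letter (q : Fˣ) (a b : Letter) (f : V F q) :
    shuffle q (consL q a f) (word q [b]) =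
      consL q a (shuffle q f (word q [b])) + consL q b (twist q b (consL q a f)) := by
  rw [← consL_nil q b, shuffle_conc, shuffle_nil_right]

theorem letter_shuffle_consL (q : Fˣ) (a b : Letter) (f : V F q) :
    shuffle q (word q [b]) (consL q a f) =
      consL q b (consL q a f) +
        superBase q ^ (bar a * bar b) • consL q a (shuffle q (word q [b]) f) := by
  rw [← consL_nil q b, shuffle_conc, shuffle_nil_left, twist_consL, twist_nil]
  simp

theorem word_pair (q : Fˣ) (a b : Letter) :
    (word q [a, b] : V F q) = consL q a (word q [b]) := by simp

theorem consL_shuffle_xy (q : Fˣ) (a : Letter) (f : V F q) :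
    shuffle q (consL q a f) (word q [.x, .y]) =
      consL q a (shuffle q f (word q [.x, .y])) +
        consL q .x (shuffle q (twist q .x (consL q a f)) (word q [.y])) := by
  rw [word_pair, shuffle_conc]

theorem xy_shuffle_consL (q : Fˣ) (a : Letter) (f : V F q) :
    shuffle q (word q [.x, .y]) (consL q a f) =
      consL q .x (shuffle q (word q [.y]) (consL q a f)) +
        consL q a (shuffle q (word q [.x, .y]) f) := by
  -- The word xy has height 0, so a letter moves past it with no scalar.
  have ht : twist q a (consL q .x (word q [.y])) = consL q .x (word q [.y]) := by
    rw [twist_consL, twist_letter, map_smul, smul_smul, ← zpow_add₀ (superBase_ne_zero q)]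
    cases a <;> simp [bar]
  rw [word_pair, shuffle_conc, ht]

/-! ### Path sums -/

/-- The weighted sum of the words followed by `b` which lead in `m` steps from height `h` to height
`0`; a step `x` from `h` has weight `1 - Q^(h+2)`, a step `y` from `h` has weight `Q^(1-h) - Q`. -/
def pathSum (q : Fˣ) (b : V F q) : ℕ → ℤ → V F q
  | 0, h => if h = 0 then b else 0
  | m + 1, h =>
      (1 - superBase q ^ (h + 2)) • consL q .x (pathSum q b m (h + 1)) +
        (superBase q ^ (1 - h) - superBase q) • consL q .y (pathSum q b m (h - 1))

theorem pathSum_succ (q : Fˣ) (b : V F q) (m : ℕ) (h : ℤ) :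
    pathSum q b (m + 1) h =
      (1 - superBase q ^ (h + 2)) • consL q .x (pathSum q b m (h + 1)) +
        (superBase q ^ (1 - h) - superBase q) • consL q .y (pathSum q b m (h - 1)) := rfl

/-- `b` has weight `e` for the twists. -/
def HasWeight (q : Fˣ) (b : V F q) (e : ℤ) : Prop :=
  ∀ c, twist q c b = superBase q ^ (bar c * e) • b

theorem twist_pathSum {q : Fˣ} {b : V F q} {e : ℤ} (hb : HasWeight q b e) (c : Letter) (m : ℕ)
    (h : ℤ) : twist q c (pathSum q b m h) =
      superBase q ^ (bar c * (e - h)) • pathSum q b m h := by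
  have hQ := superBase_ne_zero q
  induction m generalizing h with
  | zero =>
    simp only [pathSum]
    split_ifs with h0
    · rw [hb c, h0, sub_zero]
    · simp
  | succ m ih =>
    simp only [pathSum, map_add, map_smul, twist_consL, ih, smul_add, smul_smul]
    congr 2
    · rw [← zpow_add₀ hQ, mul_comm]
      congr 2
      simp only [bar]; ring
    · rw [← zpow_add₀ hQ, mul_comm]
      congr 2
      simp only [bar]; ring

/-! ### Unfolding at the first letter and the exchange with y -/

section Recursions

variable {q : Fˣ} {b : V F q} {e : ℤ} (m : ℕ) (h : ℤ)

theorem pathSum_shuffle_letter (hb : HasWeight q b e) (c : Letter) :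
    shuffle q (pathSum q b (m + 1) h) (word q [c]) =
      (1 - superBase q ^ (h + 2)) • consL q .x (shuffle q (pathSum q b m (h + 1)) (word q [c])) +
      (superBase q ^ (1 - h) - superBase q) •
        consL q .y (shuffle q (pathSum q b m (h - 1)) (word q [c])) +
      superBase q ^ (bar c * (e - h)) • consL q c (pathSum q b (m + 1) h) := by
  rw [← (consL q c).map_smul, ← twist_pathSum hb]
  simp only [pathSum, map_add, map_smul, LinearMap.add_apply, LinearMap.smul_apply,
    consL_shuffle_letter]
  module

theorem letter_shuffle_pathSum (c : Letter) :
    shuffle q (word q [c]) (pathSum q b (m + 1) h) =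
      ((1 - superBase q ^ (h + 2)) * superBase q ^ (bar c)) •
        consL q .x (shuffle q (word q [c]) (pathSum q b m (h + 1))) +
      ((superBase q ^ (1 - h) - superBase q) * superBase q ^ (-bar c)) •
        consL q .y (shuffle q (word q [c]) (pathSum q b m (h - 1))) +
      consL q c (pathSum q b (m + 1) h) := by
  simp only [pathSum, map_add, map_smul, letter_shuffle_consL, bar, one_mul, neg_one_mul]
  module

theorem pathSum_shuffle_xy (hb : HasWeight q b e) :
    shuffle q (pathSum q b (m + 1) h) (word q [.x, .y]) =
      (1 - superBase q ^ (h + 2)) •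
        consL q .x (shuffle q (pathSum q b m (h + 1)) (word q [.x, .y])) +
      (superBase q ^ (1 - h) - superBase q) •
        consL q .y (shuffle q (pathSum q b m (h - 1)) (word q [.x, .y])) +
      superBase q ^ (e - h) •
        consL q .x (shuffle q (pathSum q b (m + 1) h) (word q [.y])) := by
  have ht := twist_pathSum hb .x (m + 1) h
  rw [bar, one_mul] at ht
  rw [← (consL q .x).map_smul (superBase q ^ (e - h)),
    ← LinearMap.map_smul₂ (shuffle q) (superBase q ^ (e - h)), ← ht]
  simp only [pathSum, map_add, map_smul, LinearMap.add_apply, LinearMap.smul_apply,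
    consL_shuffle_xy]
  module

theorem xy_shuffle_pathSum :
    shuffle q (word q [.x, .y]) (pathSum q b (m + 1) h) =
      (1 - superBase q ^ (h + 2)) •
        consL q .x (shuffle q (word q [.x, .y]) (pathSum q b m (h + 1))) +
      (superBase q ^ (1 - h) - superBase q) •
        consL q .y (shuffle q (word q [.x, .y]) (pathSum q b m (h - 1))) +
      consL q .x (shuffle q (word q [.y]) (pathSum q b (m + 1) h)) := by
  simp only [pathSum, map_add, map_smul, xy_shuffle_consL]
  module

/-- The `y`-exchange relation for the path sum of length `m` from height `h`. -/
def ExchangeY (q : Fˣ) (b : V F q) (e : ℤ) (m : ℕ) (h : ℤ) : Prop :=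
  (superBase q * (1 - superBase q)) •
      (superBase q ^ (e + 1) • shuffle q (pathSum q b m h) (word q [.y]) -
        superBase q ^ (-h - 1) • shuffle q (word q [.y]) (pathSum q b m h)) =
    -(1 - superBase q ^ (h + 2)) • pathSum q b (m + 1) (h + 1)

/-- In the bracket, the words starting with the inserted y carry Q^(h+1) - Q^(-h-1), in which e has
cancelled. The inductive step is thus blind to the tail b, which matters only in length 0. The
remaining words are the hypotheses at h ± 1, weighted by the first step. -/
theorem exchangeY_of_zero (hb : HasWeight q b e) (h0 : ∀ h, ExchangeY q b e 0 h) :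
    ExchangeY q b e m h := by
  have hQ := superBase_ne_zero q
  induction m generalizing h with
  | zero => exact h0 h
  | succ m ih =>
    have hx := congrArg (consL q .x) (ih (h + 1))
    have hy := congrArg (consL q .y) (ih (h - 1))
    unfold ExchangeY at *
    rw [pathSum_shuffle_letter m h hb, letter_shuffle_pathSum, pathSum_succ q b (m + 1)]
    simp only [map_smul, map_sub, add_sub_cancel_right, sub_add_cancel, bar,
      show -(h + 1) - 1 = -h - 1 - 1 by ring, show -(h - 1) - 1 = -h - 1 + 1 by ring,
      show h + 1 + 2 = h + 3 by ring, show h - 1 + 2 = h + 1 by ring,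
      show 1 - (h + 1) = -h by ring, show -1 * (e - h) = h - e by ring] at hx hy ⊢
    linear_combination (norm := skip) (1 - superBase q ^ (h + 2)) • hx +
      (superBase q ^ (1 - h) - superBase q) • hy
    match_scalars <;> simp only [zpow_add₀ hQ, zpow_sub₀ hQ, zpow_neg] <;> field_simp <;> ring

end Recursions

/-! ### The commutator with xy -/

section Commutator

variable {q : Fˣ} {b : V F q} {e : ℤ} (m : ℕ) (h : ℤ)

/-- The value of the commutator of the path sum of length `m` from height `h` with `xy`. -/
def CommutatorXY (q : Fˣ) (b : V F q) (e : ℤ) (m : ℕ) (h : ℤ) : Prop :=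
  (superBase q * (1 - superBase q) ^ 2) •
      (shuffle q (pathSum q b m h) (word q [.x, .y]) -
        shuffle q (word q [.x, .y]) (pathSum q b m h)) =
    -((1 - superBase q) * (superBase q ^ (1 - h) - superBase q) * superBase q ^ (e + 1)) •
        shuffle q (pathSum q b (m + 1) (h - 1)) (word q [.y]) +
      (superBase q ^ (e + 1) - superBase q ^ (h + 1)) • pathSum q b (m + 2) h

/-- Unfolding leaves an extra x(Q^(e-h) P⋆y - y⋆P), where P is the path sum of length m + 1 from h.
The y-exchange removes y⋆P but produces Q^(e+h+2) P⋆y. The term in `CommutatorXY` involving a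
shuffle with y absorbs the mismatch, and its factor Q^(1-h) - Q is zero at h = 0. -/
theorem commutatorXY_of_zero (hb : HasWeight q b e) (h0 : ∀ h, ExchangeY q b e 0 h)
    (h1 : ∀ h, CommutatorXY q b e 0 h) : CommutatorXY q b e m h := by
  have hQ := superBase_ne_zero q
  induction m generalizing h with
  | zero => exact h1 h
  | succ m ih =>
    have hx := congrArg (consL q .x) (ih (h + 1))
    have hy := congrArg (consL q .y) (ih (h - 1))
    have he := congrArg (consL q .x) (exchangeY_of_zero (m + 1) h hb h0)
    unfold CommutatorXY at *
    rw [pathSum_shuffle_xy m h hb, xy_shuffle_pathSum, pathSum_shuffle_letter (m + 1) (h - 1) hb,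
      pathSum_succ q b (m + 2)]
    simp only [map_add, map_smul, map_sub, add_sub_cancel_right, sub_add_cancel, bar,
      show h + 1 + 1 = h + 2 by ring, show h - 1 + 2 = h + 1 by ring,
      show 1 - (h + 1) = -h by ring, show 1 - (h - 1) = 1 - h + 1 by ring,
      show -1 * (e - (h - 1)) = h - e - 1 by ring] at hx hy he ⊢
    -- The factor of `he` is chosen to bring the coefficient of y⋆P to Q(1-Q)².
    linear_combination (norm := skip) (1 - superBase q ^ (h + 2)) • hx +
      (superBase q ^ (1 - h) - superBase q) • hy +
      ((1 - superBase q) * superBase q ^ (h + 1)) • he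
    match_scalars <;> simp only [zpow_add₀ hQ, zpow_sub₀ hQ, zpow_neg] <;> field_simp <;> ring

end Commutator

/-! ### Length-zero cases and the exchange with x -/

variable (q : Fˣ) (m : ℕ) (h : ℤ)

theorem hasWeight_nil : HasWeight q (word q [] : V F q) 0 := fun c => by
  simp [twist_nil]

theorem hasWeight_y : HasWeight q (word q [.y] : V F q) (-1) := fun c => by
  rw [twist_letter]; rfl

theorem word_cons (a : Letter) (w : List Letter) :
    (word q (a :: w) : V F q) = consL q a (word q w) := by simp

theorem exchangeY_nil_zero : ExchangeY q (word q [] : V F q) 0 0 h := by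
  have hQ := superBase_ne_zero q
  unfold ExchangeY
  simp only [pathSum]
  split_ifs <;> first
    | omega
    | (simp only [map_zero, LinearMap.zero_apply, smul_zero, sub_self, add_zero]; done)
    | skip
  all_goals
    first
    | (have hh : h = 0 := by omega
       subst hh)
    | (have hh : h = 2 := by omega
       subst hh)
    | (have hh : h = -2 := by omega
       subst hh)
    simp [shuffleWord]
    try match_scalars <;> field_simp

theorem exchangeY_y_zero : ExchangeY q (word q [.y] : V F q) (-1) 0 h := by
  have hQ := superBase_ne_zero q
  unfold ExchangeY
  simp only [pathSum]
  split_ifs <;> first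
    | omega
    | (simp only [map_zero, LinearMap.zero_apply, smul_zero, sub_self, add_zero]; done)
    | skip
  all_goals
    first
    | (have hh : h = 0 := by omega
       subst hh)
    | (have hh : h = 2 := by omega
       subst hh)
    | (have hh : h = -2 := by omega
       subst hh)
    simp [shuffleWord, braid_eq_zpow, bar]
    try match_scalars <;> field_simp <;> ring

theorem commutatorXY_nil_zero : CommutatorXY q (word q [] : V F q) 0 0 h := by
  have hQ := superBase_ne_zero q
  unfold CommutatorXY
  simp only [pathSum]
  split_ifs <;> first
    | omega
    | (simp only [map_zero, LinearMap.zero_apply, smul_zero, sub_self, add_zero]; done)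
    | skip
  -- Paths of lengths 0, 1, 2 from h, h - 1, h reach 0 only for h = 0 or h = ±2.
  all_goals
    first
    | (have hh : h = 0 := by omega
       subst hh)
    | (have hh : h = 2 := by omega
       subst hh)
    | (have hh : h = -2 := by omega
       subst hh)
    simp [shuffleWord, braid_eq_zpow, bar]
    try match_scalars <;> field_simp <;> ring

theorem commutatorXY_y_zero : CommutatorXY q (word q [.y] : V F q) (-1) 0 h := by
  have hQ := superBase_ne_zero q
  unfold CommutatorXY
  simp only [pathSum]
  split_ifs <;> first
    | omega
    | (simp only [map_zero, LinearMap.zero_apply, smul_zero, sub_self, add_zero]; done)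
    | skip
  all_goals
    first
    | (have hh : h = 0 := by omega
       subst hh)
    | (have hh : h = 2 := by omega
       subst hh)
    | (have hh : h = -2 := by omega
       subst hh)
    simp [shuffleWord, braid_eq_zpow, bar]
    try match_scalars <;> field_simp <;> ring

/-- The `x`-exchange relation between the path sums followed by `y` and the plain path sums. -/
theorem exchangeX :
    (superBase q * (1 - superBase q)) •
        (superBase q ^ (h + 1) • shuffle q (word q [.x]) (pathSum q (word q [.y]) m h) -
          shuffle q (pathSum q (word q [.y]) m h) (word q [.x])) =
      -pathSum q (word q [] : V F q) (m + 2) h +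
        (superBase q ^ (1 - h) - superBase q) • pathSum q (word q [.y]) (m + 1) (h - 1) := by
  have hQ := superBase_ne_zero q
  -- All heights are needed for the induction; at h = 0 the last term drops out and the recursion
  -- for path sums remains.
  induction m generalizing h with
  | zero =>
    simp only [pathSum]
    split_ifs <;> first
      | omega
      | (simp only [map_zero, LinearMap.zero_apply, smul_zero, sub_self, add_zero, neg_zero]; done)
      | skip
    all_goals
      first
      | (have hh : h = 0 := by omega
         subst hh)
      | (have hh : h = 2 := by omega
         subst hh)
      | (have hh : h = -2 := by omega
         subst hh)
      simp [shuffleWord, braid_eq_zpow, bar]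
      try match_scalars <;> field_simp <;> ring
  | succ m ih =>
    have hx := congrArg (consL q .x) (ih (h + 1))
    have hy := congrArg (consL q .y) (ih (h - 1))
    rw [pathSum_shuffle_letter m h (hasWeight_y q), letter_shuffle_pathSum,
      pathSum_succ q _ (m + 1) (h - 1), pathSum_succ q _ (m + 2)]
    simp only [map_add, map_smul, map_sub, map_neg, add_sub_cancel_right, sub_add_cancel, bar,
      one_mul, show h + 1 + 1 = h + 2 by ring, show h - 1 + 2 = h + 1 by ring,
      show 1 - (h + 1) = -h by ring, show 1 - (h - 1) = 1 - h + 1 by ring] at hx hy ⊢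
    linear_combination (norm := skip) (1 - superBase q ^ (h + 2)) • hx +
      (superBase q ^ (1 - h) - superBase q) • hy
    match_scalars <;> simp only [zpow_add₀ hQ, zpow_sub₀ hQ, zpow_neg] <;> field_simp <;> ring

/-- An x step from height -2 has weight 1 - Q^0 = 0, so a path at or below -2 never returns to 0. -/
theorem pathSum_eq_zero (hh : h ≤ -2) : pathSum q (word q [] : V F q) m h = 0 := by
  induction m generalizing h with
  | zero => rw [pathSum, if_neg (by omega)]
  | succ m ih =>
    rw [pathSum, ih (h - 1) (by omega)]
    rcases eq_or_lt_of_le hh with rfl | hlt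
    · simp
    · rw [ih (h + 1) (by omega)]; simp

/-- This is how xC^s_n enters: it is, up to scale, the path sum of odd length from height -1. -/
theorem pathSum_neg_one :
    pathSum q (word q [] : V F q) (m + 1) (-1) =
      (1 - superBase q) • consL q .x (pathSum q (word q []) m 0) := by
  rw [pathSum, pathSum_eq_zero q m (-1 - 1) (by norm_num)]
  simp

theorem conc_consL (a : Letter) (f g : V F q) :
    conc q (consL q a f) g = consL q a (conc q f g) := by
  have key : conc q ∘ₗ consL q a = (conc q).compr₂ (consL q a) :=
    ext_words fun u => ext_words fun v => by simp
  simpa using LinearMap.congr_fun (LinearMap.congr_fun key f) g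

theorem conc_pathSum (b : V F q) :
    conc q (pathSum q (word q []) m h) b = pathSum q b m h := by
  induction m generalizing h with
  | zero =>
    have hb : conc q (word q []) b = b := by
      have key : conc q (word q []) = LinearMap.id := ext_words fun u => by simp
      simp [key]
    simp only [pathSum]
    split_ifs <;> simp [hb]
  | succ m ih =>
    simp only [pathSum, map_add, map_smul, LinearMap.add_apply, LinearMap.smul_apply, conc_consL,
      ih]

/-! ### Insertion of a letter -/

theorem letter_shuffle_word (c : Letter) (u : List Letter) :
    shuffle q (word q [c]) (word q u) = ∑ i ∈ Finset.range (u.length + 1),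
      superBase q ^ (bar c * height (u.take i)) • word q (u.take i ++ c :: u.drop i) := by
  have hQ := superBase_ne_zero q
  induction u with
  | nil => simp [shuffleWord]
  | cons a u ih =>
    rw [word_cons q a u, letter_shuffle_consL, ih, List.length_cons,
      Finset.sum_range_succ' _ (u.length + 1), add_comm, map_sum, Finset.smul_sum]
    congr 1
    · refine Finset.sum_congr rfl fun i _ => ?_
      simp [smul_smul, mul_add, zpow_add₀ hQ, mul_comm]
    · simp

theorem word_shuffle_letter (c : Letter) (u : List Letter) :
    shuffle q (word q u) (word q [c]) = ∑ i ∈ Finset.range (u.length + 1),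
      superBase q ^ (bar c * (height u - height (u.take i))) •
        word q (u.take i ++ c :: u.drop i) := by
  induction u with
  | nil => simp [shuffleWord]
  | cons a u ih =>
    rw [word_cons q a u, consL_shuffle_letter, ih, List.length_cons,
      Finset.sum_range_succ' _ (u.length + 1), map_sum]
    congr 1
    · refine Finset.sum_congr rfl fun i _ => ?_
      simp
    · simp [twist, braid_eq_zpow]

theorem neg_one_pow_eq_zpow_height (v : List Letter) :
    (-1 : F) ^ v.length = (-1) ^ height v := by
  induction v with
  | nil => simp
  | cons a v ih =>
    rw [height_cons, zpow_add₀ (by simp), ← ih]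
    cases a <;> simp [bar, pow_succ]

/-- Under Q = -q² the sign (-1)^i of the definition is absorbed into the powers of Q, because i has
the parity of the height k. -/
theorem neg_one_pow_mul_superBracket (hq : (q : F) + (q : F)⁻¹ ≠ 0) (i : ℕ) (k : ℤ)
    (hik : (-1 : F) ^ i = (-1) ^ k) :
    ((q : F) + (q : F)⁻¹) * ((-1) ^ i * superBracket q (2 + 2 * k)) =
      superBase q ^ (k + 1) - superBase q ^ (-(k + 1)) := by
  have h2 : ∀ n : ℤ, superBase q ^ n = (-1) ^ n * (q : F) ^ (2 * n) := fun n => by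
    rw [superBase, neg_eq_neg_one_mul, mul_zpow, zpow_mul, zpow_ofNat]
  have h1 : (-1 : F) ^ (-(k + 1)) = (-1) ^ (k + 1) := by
    rw [zpow_neg, ← inv_zpow]; simp
  have h3 : ((-1 : Fˣ) ^ (2 + 2 * k)) = 1 := by
    rw [← mul_one_add, zpow_mul]; simp
  rw [superBracket, hik, h3, one_mul, h2, h2, h1, zpow_add₀ (by simp : (-1 : F) ≠ 0),
    mul_left_comm, mul_div_cancel₀ _ hq, show 2 * (k + 1) = 2 + 2 * k by ring,
    show 2 * -(k + 1) = -(2 + 2 * k) by ring]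
  push_cast
  ring

/-- As vy has height -1, inserting x at height k contributes Q^(k+1) - Q^(-k-1). After the final y,
k = -1 and this is zero, so only the insertions allowed in the definition of C^s remain. -/
theorem exchange_word (hq : (q : F) + (q : F)⁻¹ ≠ 0) (v : List Letter) (hv : height v = 0) :
    superBase q • shuffle q (word q [.x]) (word q (v ++ [.y])) -
        shuffle q (word q (v ++ [.y])) (word q [.x]) =
      ((q : F) + (q : F)⁻¹) • ∑ i ∈ Finset.range (v.length + 1),
        ((-1) ^ i * superBracket q (2 + 2 * height (v.take i))) •
          word q (v.take i ++ .x :: (v.drop i ++ [.y])) := by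
  have hQ := superBase_ne_zero q
  rw [letter_shuffle_word, word_shuffle_letter, List.length_append, List.length_singleton,
    Finset.sum_range_succ, Finset.sum_range_succ _ (v.length + 1), smul_add, Finset.smul_sum,
    Finset.smul_sum, add_sub_add_comm, ← Finset.sum_sub_distrib]
  have hlast : v.length + 1 = (v ++ [Letter.y]).length := by simp
  rw [hlast, List.take_length]
  simp only [height_append, hv, bar, smul_smul]
  rw [← hlast]
  conv_rhs => rw [← add_zero (Finset.sum _ _)]
  congr 1
  · refine Finset.sum_congr rfl fun i hi => ?_
    have hi' : i ≤ v.length := by simpa [Nat.lt_succ_iff] using hi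
    rw [List.take_append_of_le_length hi', List.drop_append_of_le_length hi', ← sub_smul,
      neg_one_pow_mul_superBracket q hq]
    · congr 1
      simp only [height_cons, height_nil, bar]
      rw [zpow_add_one₀ hQ, one_mul, one_mul]
      congr 1
      · ring
      · congr 1; ring
    · rw [← neg_one_pow_eq_zpow_height, List.length_take_of_le hi']
  · simp [bar, hQ]

/-! ### Catalan elements as path sums -/

theorem mem_Cat {n : ℕ} {w : List Letter} : w ∈ Cat n ↔ w.length = 2 * n ∧ IsCatalan w := by
  simp only [Cat, Finset.mem_filter, Finset.mem_image, Finset.mem_univ, true_and]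
  refine and_congr_left fun _ => ⟨?_, fun hw => ?_⟩
  · rintro ⟨f, rfl⟩; simp
  · exact ⟨fun i => w.get (i.cast hw.symm), by
      apply List.ext_get <;> simp [hw]⟩

theorem isCatalan_iff_prefix {w : List Letter} :
    IsCatalan w ↔ height w = 0 ∧ ∀ p, p <+: w → 0 ≤ height p := by
  refine and_congr_right fun _ => ⟨fun hw p hp => ?_, fun hw i _ => hw _ (List.take_prefix i w)⟩
  rw [List.prefix_iff_eq_take.1 hp]
  exact hw _ hp.length_le

theorem insert_mem_Cat {n : ℕ} {v : List Letter} (hv : v ∈ Cat n) (i : ℕ) :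
    v.take i ++ .x :: (v.drop i ++ [.y]) ∈ Cat (n + 1) := by
  obtain ⟨hl, hc⟩ := mem_Cat.1 hv
  obtain ⟨h0, hp⟩ := isCatalan_iff_prefix.1 hc
  have hsplit : height (v.take i) + height (v.drop i) = 0 := by
    rw [← height_append, List.take_append_drop, h0]
  have htot : height (v.take i ++ .x :: (v.drop i ++ [.y])) = 0 := by
    simp only [height_append, height_cons, bar, height_nil]; linarith
  refine mem_Cat.2 ⟨?_, isCatalan_iff_prefix.2 ⟨htot, fun p hpre => ?_⟩⟩
  · have := congrArg List.length (List.take_append_drop i v)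
    simp only [List.length_append, List.length_cons, List.length_nil] at this ⊢
    omega
  · obtain ⟨r, hr⟩ := hpre
    rcases List.append_eq_append_iff.1 hr with ⟨s, hs, -⟩ | ⟨s, rfl, hs⟩
    · exact hp _ ((hs ▸ List.prefix_append p s).trans (List.take_prefix i v))
    -- A prefix reaching past the insertion point ends just before x, is the whole word, or is a
    -- prefix of v raised by one.
    · replace hs := hs ▸ List.prefix_append s r
      rcases List.prefix_cons_iff.1 hs with rfl | ⟨t, rfl, ht⟩
      · simpa using hp _ (List.take_prefix i v)
      · rcases List.prefix_concat_iff.1 ht with rfl | ht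
        · exact htot.ge
        · have := hp (v.take i ++ t) (by
            conv_rhs => rw [← List.take_append_drop i v]
            exact (List.prefix_append_right_inj _).2 ht)
          simp only [height_append, height_cons, bar] at this ⊢
          linarith

theorem catalanElt_zero : catalanElt q 0 = (word q [] : V F q) := by
  have : Cat 0 = {[]} := by
    ext w
    rw [mem_Cat, Finset.mem_singleton]
    refine ⟨fun hw => List.eq_nil_of_length_eq_zero hw.1, ?_⟩
    rintro rfl
    simp [IsCatalan]
  simp [catalanElt, this, catCoeff]

/-- The order of summation is reversed: each insertion into v yields exactly one w, which is
Catalan, so the test for w collapses. -/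
theorem catalanElt_succ (n : ℕ) :
    (catalanElt q (n + 1) : V F q) = ∑ v ∈ Cat n, catCoeff q n v •
      ∑ i ∈ Finset.range (v.length + 1),
        ((-1) ^ i * superBracket q (2 + 2 * height (v.take i))) •
          word q (v.take i ++ .x :: (v.drop i ++ [.y])) := by
  simp only [catalanElt, catCoeff, Finset.sum_smul, Finset.sum_filter, Finset.mul_sum,
    Finset.smul_sum]
  rw [Finset.sum_comm]
  refine Finset.sum_congr rfl fun v hv => ?_
  rw [Finset.sum_comm]
  refine Finset.sum_congr rfl fun i _ => ?_
  simp only [mul_ite, mul_zero, ite_smul, zero_smul]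
  rw [Finset.sum_ite_eq', if_pos (insert_mem_Cat hv i), smul_smul]

theorem exchange_catalanElt (hq : (q : F) + (q : F)⁻¹ ≠ 0) (n : ℕ) :
    superBase q • shuffle q (word q [.x]) (conc q (catalanElt q n) (word q [.y])) -
        shuffle q (conc q (catalanElt q n) (word q [.y])) (word q [.x]) =
      ((q : F) + (q : F)⁻¹) • catalanElt q (n + 1) := by
  rw [catalanElt_succ]
  simp only [catalanElt, map_sum, map_smul, LinearMap.sum_apply, LinearMap.smul_apply, conc_word]
  rw [Finset.smul_sum, Finset.smul_sum, ← Finset.sum_sub_distrib]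
  refine Finset.sum_congr rfl fun v hv => ?_
  rw [smul_comm _ (catCoeff q n v), ← smul_sub, exchange_word q hq v (mem_Cat.1 hv).2.1,
    smul_comm]

/-! ### The product formula and the relations for Catalan elements -/

theorem superBase_mul_one_sub :
    superBase q * (1 - superBase q) = -((q : F) ^ 3 * ((q : F) + (q : F)⁻¹)) := by
  have := q.ne_zero
  rw [superBase]; field_simp; ring

/-- The scalar relating Catalan elements and path sums. -/
def catalanScale (q : Fˣ) : F := ((q : F) ^ 3 * ((q : F) + (q : F)⁻¹) ^ 2)⁻¹

/-- Both families are generated by the same bracket with x. The scale is the ratio of the two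
constants: Q(1-Q) = -q³(q + q⁻¹) on one side and q + q⁻¹ on the other. -/
theorem catalanElt_eq_pathSum (hq : (q : F) + (q : F)⁻¹ ≠ 0) (n : ℕ) :
    catalanElt q n = catalanScale q ^ n • pathSum q (word q [] : V F q) (2 * n) 0 := by
  induction n with
  | zero => simp [catalanElt_zero, pathSum]
  | succ n ih =>
    have hq0 := q.ne_zero
    have key := exchangeX q (2 * n) 0
    have hc := exchange_catalanElt q hq n
    rw [ih] at hc
    simp only [map_smul, LinearMap.smul_apply, conc_pathSum] at hc
    rw [superBase_mul_one_sub] at key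
    have hs : catalanScale q = ((q : F) ^ 3 * ((q : F) + (q : F)⁻¹) ^ 2)⁻¹ := rfl
    generalize (q : F) + (q : F)⁻¹ = z at *
    simp only [zero_add, zpow_one, sub_zero, sub_self, zero_smul, add_zero] at key
    -- The recursion determines only (q + q⁻¹) C^s_{n+1}, so the goal is first multiplied by that
    -- nonzero scalar.
    rw [← sub_eq_zero, ← smul_eq_zero_iff_right hq, mul_add, mul_one]
    linear_combination (norm := skip) 
      -hc - (((q : F) ^ 3 * z)⁻¹ * catalanScale q ^ n) • key
    rw [pow_succ]
    generalize catalanScale q ^ n = c at *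
    rw [hs]
    match_scalars <;> field_simp <;> ring

theorem one_sub_superBase : 1 - superBase q = (q : F) * ((q : F) + (q : F)⁻¹) := by
  have := q.ne_zero
  rw [superBase]; field_simp; ring

theorem xy_shuffle_catalanElt_y (hq : (q : F) + (q : F)⁻¹ ≠ 0) (n : ℕ) :
    shuffle q (word q [.x, .y]) (conc q (catalanElt q n) (word q [.y])) -
        shuffle q (conc q (catalanElt q n) (word q [.y])) (word q [.x, .y]) =
      ((q : F) + (q : F)⁻¹) • conc q (catalanElt q (n + 1)) (word q [.y]) := by
  have hq0 := q.ne_zero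
  have key := commutatorXY_of_zero (2 * n) 0 (hasWeight_y q) (exchangeY_y_zero q)
    (commutatorXY_y_zero q)
  unfold CommutatorXY at key
  have hs : catalanScale q = ((q : F) ^ 3 * ((q : F) + (q : F)⁻¹) ^ 2)⁻¹ := rfl
  have h1 := one_sub_superBase q
  rw [pow_two, ← mul_assoc, superBase_mul_one_sub, one_sub_superBase] at key
  simp only [sub_zero, zpow_one, sub_self, mul_zero, zero_mul, neg_zero, zero_smul, zero_add,
    neg_add_cancel, zpow_zero, h1] at key
  simp only [catalanElt_eq_pathSum q hq, map_smul, LinearMap.smul_apply, conc_pathSum, mul_add,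
    mul_one]
  generalize (q : F) + (q : F)⁻¹ = z at *
  rw [pow_succ]
  generalize catalanScale q ^ n = c at *
  rw [hs]
  linear_combination (norm := skip) (c * ((q : F) ^ 4 * z ^ 2)⁻¹) • key
  match_scalars <;> field_simp <;> ring

/-- With empty tail, e = h = 0, and both coefficients on the right of `CommutatorXY` vanish. -/
theorem commute_catalanElt_xy (hq : (q : F) + (q : F)⁻¹ ≠ 0) (n : ℕ) :
    shuffle q (catalanElt q n) (word q [.x, .y]) =
      shuffle q (word q [.x, .y]) (catalanElt q n) := by
  have hQ := superBase_ne_zero q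
  have h1 : 1 - superBase q ≠ 0 := by
    rw [one_sub_superBase]; exact mul_ne_zero q.ne_zero hq
  have key := commutatorXY_of_zero (2 * n) 0 (hasWeight_nil q) (exchangeY_nil_zero q)
    (commutatorXY_nil_zero q)
  unfold CommutatorXY at key
  simp only [sub_zero, zpow_one, sub_self, mul_zero, zero_mul, neg_zero, zero_smul, zero_add,
    smul_eq_zero, hQ, h1, mul_eq_zero, pow_eq_zero_iff two_ne_zero, false_or] at key
  simp only [catalanElt_eq_pathSum q hq, map_smul, LinearMap.smul_apply, sub_eq_zero.1 key]

/-- This is the y-exchange with empty tail at h = -1, where the path sum on the right starts from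
height 0. -/
theorem exchange_x_catalanElt (hq : (q : F) + (q : F)⁻¹ ≠ 0) (n : ℕ) :
    superBase q • shuffle q (consL q .x (catalanElt q n)) (word q [.y]) -
        shuffle q (word q [.y]) (consL q .x (catalanElt q n)) =
      ((q : F) + (q : F)⁻¹) • catalanElt q (n + 1) := by
  have hq0 := q.ne_zero
  have key := exchangeY_of_zero (2 * n + 1) (-1) (hasWeight_nil q) (exchangeY_nil_zero q)
  unfold ExchangeY at key
  have hs : catalanScale q = ((q : F) ^ 3 * ((q : F) + (q : F)⁻¹) ^ 2)⁻¹ := rfl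
  rw [pathSum_neg_one, superBase_mul_one_sub, show (-1 : ℤ) + 2 = 1 by norm_num, zpow_one,
    one_sub_superBase] at key
  simp only [zero_add, zpow_one, neg_neg, sub_self, zpow_zero, neg_add_cancel, one_smul, map_smul,
    LinearMap.smul_apply] at key
  simp only [catalanElt_eq_pathSum q hq, map_smul, LinearMap.smul_apply, mul_add, mul_one]
  generalize (q : F) + (q : F)⁻¹ = z at *
  rw [pow_succ]
  generalize catalanScale q ^ n = c at *
  rw [hs]
  linear_combination (norm := skip) -(c * ((q : F) ^ 4 * z ^ 2)⁻¹) • key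
  match_scalars <;> field_simp <;> ring

/-- Peeling off the leading x leaves x[C^s_n, xy], which is zero, plus x applied to the y-exchange
bracket of xC^s_n. -/
theorem x_catalanElt_shuffle_xy (hq : (q : F) + (q : F)⁻¹ ≠ 0) (n : ℕ) :
    shuffle q (consL q .x (catalanElt q n)) (word q [.x, .y]) -
        shuffle q (word q [.x, .y]) (consL q .x (catalanElt q n)) =
      ((q : F) + (q : F)⁻¹) • consL q .x (catalanElt q (n + 1)) := by
  have ht : twist q .x (consL q .x (catalanElt q n)) =
      superBase q • consL q .x (catalanElt q n) := by
    rw [twist_consL, catalanElt_eq_pathSum q hq, map_smul, twist_pathSum (hasWeight_nil q)]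
    simp [bar]
  rw [consL_shuffle_xy, xy_shuffle_consL, ht, commute_catalanElt_xy q hq,
    ← (consL q .x).map_smul ((q : F) + (q : F)⁻¹),
    ← exchange_x_catalanElt q hq]
  simp only [map_smul, map_sub, LinearMap.smul_apply]
  abel

/-! ### Images of the root vectors -/

theorem phi_Edelta :
    phi q (Edelta q : Uplus F q) =
      (((q : F) ^ 2)⁻¹ * (((q : F) + (q : F)⁻¹) * ((q : F) - (q : F)⁻¹))) •
        word q [.x, .y] := by
  have hq := q.ne_zero
  simp only [Edelta, map_add, map_smul, map_mul, phi_genA, phi_genB, mul_def, shuffle_word,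
    shuffleWord, conc_word, braid_eq_zpow, List.cons_append, List.nil_append, height_cons,
    height_nil, bar, superBase]
  -- The yx terms cancel, leaving 1 - q⁻⁴ on xy.
  match_scalars <;> norm_num <;> field_simp <;> ring

theorem superComm_even_right {R : Type*} [Ring R] (β : ℕ × ℕ) (a b : R) :
    superComm β (1, 1) a b = a * b - b * a := by
  simp [superComm, parity]

theorem superComm_even_left {R : Type*} [Ring R] (β : ℕ × ℕ) (a b : R) :
    superComm (1, 1) β a b = a * b - b * a := by
  simp [superComm, parity]

theorem phi_Ereal0 (hp : (q : F) + (q : F)⁻¹ ≠ 0) (hm : (q : F) - (q : F)⁻¹ ≠ 0) (n : ℕ) :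
    phi q (Ereal0 q n) = (((q : F) ^ 2)⁻¹ * ((q : F) + (q : F)⁻¹) ^ 2) ^ n •
      conc q (word q [.x]) (catalanElt q n) := by
  induction n with
  | zero => simp [Ereal0, phi_genA, catalanElt_zero]
  | succ n ih =>
    have key := x_catalanElt_shuffle_xy q hp n
    simp only [Ereal0, superComm_even_right, map_smul, map_sub, map_mul, ih, phi_Edelta, mul_def,
      LinearMap.smul_apply]
    rw [pow_succ _ n]
    have hq0 := q.ne_zero
    generalize (q : F) + (q : F)⁻¹ = z at *
    generalize (q : F) - (q : F)⁻¹ = y at *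
    generalize (((q : F) ^ 2)⁻¹ * z ^ 2) ^ n = c at *
    linear_combination (norm := skip) (c * ((q : F) ^ 2)⁻¹ * z) • key
    match_scalars <;> field_simp <;> ring

theorem phi_Ereal1 (hp : (q : F) + (q : F)⁻¹ ≠ 0) (hm : (q : F) - (q : F)⁻¹ ≠ 0) (n : ℕ) :
    phi q (Ereal1 q n) = (((q : F) ^ 2)⁻¹ * ((q : F) + (q : F)⁻¹) ^ 2) ^ n •
      conc q (catalanElt q n) (word q [.y]) := by
  induction n with
  | zero => simp [Ereal1, phi_genB, catalanElt_zero]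
  | succ n ih =>
    have key := xy_shuffle_catalanElt_y q hp n
    simp only [Ereal1, superComm_even_left, map_smul, map_sub, map_mul, ih, phi_Edelta, mul_def,
      LinearMap.smul_apply]
    rw [pow_succ _ n]
    have hq0 := q.ne_zero
    generalize (q : F) + (q : F)⁻¹ = z at *
    generalize (q : F) - (q : F)⁻¹ = y at *
    generalize (((q : F) ^ 2)⁻¹ * z ^ 2) ^ n = c at *
    linear_combination (norm := skip) (c * ((q : F) ^ 2)⁻¹ * z) • key
    match_scalars <;> field_simp <;> ring

theorem phi_Eimag (hp : (q : F) + (q : F)⁻¹ ≠ 0) (hm : (q : F) - (q : F)⁻¹ ≠ 0) (n : ℕ) :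
    phi q (Eimag q (n + 1)) =
      (-((((q : F) ^ 2)⁻¹ * ((q : F) + (q : F)⁻¹) ^ 2) ^ n *
        (((q : F) ^ 2)⁻¹ * ((q : F) + (q : F)⁻¹)))) • catalanElt q (n + 1) := by
  have hq := q.ne_zero
  have key := exchange_catalanElt q hp n
  simp only [Eimag, map_add, map_smul, map_mul, phi_Ereal1 q hp hm, phi_genA, mul_def,
    LinearMap.smul_apply]
  rw [superBase] at key
  generalize (q : F) + (q : F)⁻¹ = z at *
  generalize (((q : F) ^ 2)⁻¹ * z ^ 2) ^ n = c at *
  -- The form x⋆w + q⁻² w⋆x is Q⁻¹(Q x⋆w - w⋆x), and Q⁻¹ = -q⁻² is the source of the minus sign.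
  linear_combination (norm := skip) -(c * ((q : F) ^ 2)⁻¹) • key
  match_scalars <;> field_simp <;> ring

theorem scale_pow (n : ℕ) :
    (((q : F) ^ 2)⁻¹ * ((q : F) + (q : F)⁻¹) ^ 2) ^ n =
      (q : F) ^ (-2 * (n : ℤ)) * ((q : F) + (q : F)⁻¹) ^ (2 * (n : ℤ)) := by
  rw [mul_pow, zpow_mul, zpow_mul, zpow_natCast, zpow_natCast, zpow_neg, zpow_ofNat,
    zpow_ofNat]

end

end C22


theorem theorem24 {F : Type*} [Field F] [CharZero F] (q : Fˣ)
    (hq : ∀ n : ℕ, 0 < n → q ^ n ≠ 1) :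
    (∀ n : ℕ,
      C22.phi q (C22.Ereal0 q n) =
        ((q : F) ^ (-2 * (n : ℤ)) * ((q : F) + (q : F)⁻¹) ^ (2 * (n : ℤ))) •
          C22.conc q (C22.word q [C22.Letter.x]) (C22.catalanElt q n)) ∧
    (∀ n : ℕ,
      C22.phi q (C22.Ereal1 q n) =
        ((q : F) ^ (-2 * (n : ℤ)) * ((q : F) + (q : F)⁻¹) ^ (2 * (n : ℤ))) •
          C22.conc q (C22.catalanElt q n) (C22.word q [C22.Letter.y])) ∧
    (∀ n : ℕ, 1 ≤ n →
      C22.phi q (C22.Eimag q n) =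
        (-((q : F) ^ (-2 * (n : ℤ)) * ((q : F) + (q : F)⁻¹) ^ (2 * (n : ℤ) - 1))) •
          C22.catalanElt q n) := by
  have hq0 : (q : F) ≠ 0 := q.ne_zero
  have hm : (q : F) - (q : F)⁻¹ ≠ 0 := fun h => hq 2 two_pos <| by
    ext
    push_cast
    rw [sub_eq_zero] at h
    rw [pow_two]
    nth_rw 1 [h]
    exact inv_mul_cancel₀ hq0
  have hp : (q : F) + (q : F)⁻¹ ≠ 0 := fun h => hq 4 four_pos <| by
    ext
    push_cast
    have h2 : (q : F) ^ 2 = -1 := by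
      field_simp at h
      linear_combination h
    linear_combination ((q : F) ^ 2 - 1) * h2
  refine ⟨fun n => ?_, fun n => ?_, fun n hn => ?_⟩
  · rw [C22.phi_Ereal0 q hp hm, C22.scale_pow]
  · rw [C22.phi_Ereal1 q hp hm, C22.scale_pow]
  · obtain ⟨n, rfl⟩ := Nat.exists_eq_add_of_le' hn
    rw [C22.phi_Eimag q hp hm, C22.scale_pow]
    congr 2
    push_cast
    rw [show -2 * ((n : ℤ) + 1) = -2 * n - 2 by ring,
      show 2 * ((n : ℤ) + 1) - 1 = 2 * n + 1 by ring, zpow_sub₀ hq0, zpow_add_one₀ hp, zpow_ofNat]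
    ring
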